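/- Let $\mathbb T=\mathbb R/\mathbb Z$ and let $\Omega=(-\tfrac12,\tfrac12)\subset\mathbb T$, i.e. $\Omega=\mathbb T\setminus\{\tfrac12\}$. For $z\in\mathbb T$ put $$\mathcal M^*(\Omega,z):=\sup_{f\in\mathcal F^*(\Omega)} f(z),$$ where $\mathcal F^*(\Omega)$ is the set of functions $f:\mathbb T\to\mathbb R$ whose closed support is contained in $\Omega$, with $f(0)=1$, and which are positive definite, meaning that all Fourier coefficients $\widehat f(n)=\int_{\mathbb T}f(x)e^{-2\pi i n x}\,dx$, $n\in\mathbb Z$, are real and nonnegative. Here the functions $f$ are taken from any one of the following three classes: integrable functions that are continuous at $0$ and at $z$; continuous functions; $C^\infty$ functions. For each of these three choices: (i) if $z=p/q$ with $p\in\mathbb Z$, $q\ge 1$, $\gcd(p,q)=1$ and $q$ even, then $\mathcal M^*(\Omega,z)=\tfrac12\left(1+\cos\tfrac{2\pi}{q}\right)$; (ii) if $z=p/q$ with $p\in\mathbb Z$, $q\ge 1$, $\gcd(p,q)=1$ and $q$ odd, then $\mathcal M^*(\Omega,z)=1$; (iii) if $z\in\mathbb R$ is irrational, then $\mathcal M^*(\Omega,z)=1$.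 -/

import Mathlib

open scoped ContDiff

/-- The three function classes on the torus `𝕋 = ℝ/ℤ` over which the extremal problem is posed. -/
inductive Regularity where
  | integrable
  | continuous
  | smooth

/-- `r.Holds z f`: the function `f : 𝕋 → ℝ` has regularity `r`. In the integrable case `f` is also
required to be continuous at the two points `0` and `z` where its values are used. In the smooth
case, smoothness on `𝕋` is smoothness of the `1`-periodic lift to `ℝ`. -/
def Regularity.Holds (r : Regularity) (z : UnitAddCircle) (f : UnitAddCircle → ℝ) : Prop :=
  match r with
  | .integrable =>
      MeasureTheory.Integrable f AddCircle.haarAddCircle ∧ ContinuousAt f 0 ∧ ContinuousAt f z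
  | .continuous => Continuous f
  | .smooth => ContDiff ℝ ∞ (fun x : ℝ => f (x : UnitAddCircle))

/-- Positive definiteness on `𝕋`: every Fourier coefficient is real and nonnegative. -/
def TorusPosDef (f : UnitAddCircle → ℝ) : Prop :=
  ∀ n : ℤ, 0 ≤ (fourierCoeff (fun x => (f x : ℂ)) n).re ∧
    (fourierCoeff (fun x => (f x : ℂ)) n).im = 0

/-- The class `𝓕*(Ω)`: positive definite functions with (closed) support in `Ω` and value `1`
at the origin. -/
def FStar (r : Regularity) (Ω : Set UnitAddCircle) (z : UnitAddCircle) :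
    Set (UnitAddCircle → ℝ) :=
  {f | r.Holds z f ∧ tsupport f ⊆ Ω ∧ f 0 = 1 ∧ TorusPosDef f}

/-- The extremal value `𝓜*(Ω, z) = sup {f(z) : f ∈ 𝓕*(Ω)}`, as a supremum of extended reals. -/
noncomputable def MStar (r : Regularity) (Ω : Set UnitAddCircle) (z : UnitAddCircle) : EReal :=
  ⨆ f ∈ FStar r Ω z, ((f z : ℝ) : EReal)

/-- The open arc `(-1/2, 1/2)` in the torus. -/
def openArc : Set UnitAddCircle :=
  (fun x : ℝ => (x : UnitAddCircle)) '' Set.Ioo (-(1 / 2) : ℝ) (1 / 2)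

open MeasureTheory AddCircle Filter Topology
open scoped FourierTransform Convolution

/-! The proof is a linear programming duality, in which the value `f (1/2) = 0` is the only
constraint that the support condition contributes.

Upper bound: if `cos (2πnz) ≤ α + β cos (πn)` for every integer `n`, weighting by the nonnegative
Fourier coefficients gives `f z ≤ α * f 0 + β * f (1/2) = α`. The bound 1 is trivial. For `z = p/q`
with `q` even, an odd `n` never makes `n * p / q` an integer, so the left side is at most `cos
(2π/q)`, and `α`, `β` solve `α + β = 1`, `α - β = cos (2π/q)`. Since `f` may be merely integrable,
Fourier inversion is replaced by an approximate identity with nonnegative coefficients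
(`TorusPosDef.apply_le`).

Lower bound: a finitely supported positive definite measure with mass 1 at 0 and none at 1/2,
convolved with a narrow smooth positive definite bump, is admissible in all three classes
(`le_MStar_of_weights`). On the subgroup generated by `p/q` the weights are `(1 + cos (2πk/q))/2`
for `q` even, which vanish at 1/2, and 1 for `q` odd, when 1/2 is not in the subgroup. For
irrational `z`, Fejér weights on the multiples of `z` give values tending to 1. -/

/-! ### Smooth positive definite bumps -/

/-- There are smooth positive definite functions on `ℝ` with arbitrarily small support. -/
theorem exists_contDiff_posDef_bump {δ : ℝ} (hδ : 0 < δ) :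
    ∃ ψ : ℝ → ℝ, ContDiff ℝ ∞ ψ ∧ ψ 0 = 1 ∧ (∀ x, δ ≤ |x| → ψ x = 0) ∧
      ∀ ξ : ℝ, 0 ≤ (𝓕 (fun x => (ψ x : ℂ)) ξ).re ∧ (𝓕 (fun x => (ψ x : ℂ)) ξ).im = 0 := by
  let φ : ContDiffBump (0 : ℝ) := ⟨δ / 4, δ / 2, by linarith, by linarith⟩
  have hφc : Continuous φ := φ.continuous
  set ρ : ℝ → ℝ := (φ : ℝ → ℝ) ⋆[ContinuousLinearMap.mul ℝ ℝ, volume] (φ : ℝ → ℝ) with hρ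
  have hρs : ContDiff ℝ ∞ ρ :=
    φ.hasCompactSupport.contDiff_convolution_right _ hφc.locallyIntegrable φ.contDiff
  have hρ0 : 0 < ρ 0 := by
    have h1 : ρ 0 = ∫ t, φ t * φ t := by
      simp [hρ, convolution_def, φ.neg]
    rw [h1]
    refine Continuous.integral_pos_of_hasCompactSupport_nonneg_nonzero (x := 0)
      (hφc.mul hφc) ?_ (fun x => mul_self_nonneg _) ?_
    · exact φ.hasCompactSupport.mul_right
    · have : φ 0 = 1 := φ.one_of_mem_closedBall (by simp [φ.rIn_pos.le])
      simp [this]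
  have hsupp : ∀ x, δ ≤ |x| → ρ x = 0 := by
    intro x hx
    rw [hρ, convolution_def]
    apply integral_eq_zero_of_ae
    filter_upwards with t
    by_cases ht : δ / 2 ≤ |t|
    · have : φ t = 0 := φ.zero_of_le_dist (by simpa [φ] using ht)
      simp [this]
    · have : φ (x - t) = 0 := φ.zero_of_le_dist (by
        have := abs_sub_abs_le_abs_sub x t
        simp only [dist_zero_right, Real.norm_eq_abs]
        change δ / 2 ≤ _
        linarith)
      simp [this]
  let Φ : ℝ → ℂ := fun x => (φ x : ℂ)
  have hΦc : Continuous Φ := Complex.continuous_ofReal.comp hφc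
  have hΦs : HasCompactSupport Φ := φ.hasCompactSupport.comp_left (g := ((↑) : ℝ → ℂ)) rfl
  have hΦi : Integrable Φ := hΦc.integrable_of_hasCompactSupport hΦs
  have hconv : (fun x => (ρ x : ℂ)) = Φ ⋆[ContinuousLinearMap.mul ℂ ℂ, volume] Φ := by
    ext x
    simp only [hρ, convolution_def, ContinuousLinearMap.mul_apply', Φ]
    rw [← integral_complex_ofReal]
    simp
  have hreal : ∀ ξ : ℝ, (𝓕 Φ ξ).im = 0 := by
    intro ξ
    -- Conjugation is undone by `v ↦ -v` because `φ` is even; hence the transform of `φ ⋆ φ` is the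
    -- square of a real number.
    rw [← Complex.conj_eq_iff_im, Real.fourier_real_eq, ← integral_conj, ← integral_neg_eq_self]
    congr 1
    ext v
    simp [Φ, φ.neg, Circle.smul_def, ← Circle.coe_inv_eq_conj, ← AddChar.map_neg_eq_inv]
  refine ⟨fun x => (ρ 0)⁻¹ * ρ x, contDiff_const.mul hρs, inv_mul_cancel₀ hρ0.ne',
    fun x hx => by simp [hsupp x hx], fun ξ => ?_⟩
  have h2 : 𝓕 (fun x => (((ρ 0)⁻¹ * ρ x : ℝ) : ℂ)) ξ = (((ρ 0)⁻¹ * (𝓕 Φ ξ).re ^ 2 : ℝ) : ℂ) := by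
    have h3 : 𝓕 (fun x => (ρ x : ℂ)) ξ = 𝓕 Φ ξ * 𝓕 Φ ξ := by
      rw [hconv]; exact Real.fourier_mul_convolution_eq hΦi hΦi ξ
    have h4 : 𝓕 Φ ξ = ((𝓕 Φ ξ).re : ℂ) := Complex.ext (by simp) (by simp [hreal ξ])
    rw [Real.fourier_real_eq] at h3 ⊢
    have : ∀ v, Real.fourierChar (-(v * ξ)) • (((ρ 0)⁻¹ * ρ v : ℝ) : ℂ) =
        ((ρ 0)⁻¹ : ℂ) * (Real.fourierChar (-(v * ξ)) • (ρ v : ℂ)) := by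
      intro v; simp only [Circle.smul_def, smul_eq_mul]; push_cast; ring
    simp_rw [this]
    rw [integral_const_mul, h3, h4, Complex.ofReal_re]
    push_cast
    ring
  rw [h2]
  exact ⟨by rw [Complex.ofReal_re]; positivity, Complex.ofReal_im _⟩

/-- There are smooth positive definite functions on `ℝ/ℤ` with arbitrarily small support. -/
theorem UnitAddCircle.exists_smooth_torusPosDef_bump {ε : ℝ} (hε : 0 < ε) :
    ∃ B : UnitAddCircle → ℝ, ContDiff ℝ ∞ (fun x : ℝ => B (x : UnitAddCircle)) ∧ B 0 = 1 ∧
      (∀ x, ε ≤ ‖x‖ → B x = 0) ∧ TorusPosDef B := by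
  -- The cap 1/4 keeps the support away from ±1/2, so the periodization is smooth across the seam.
  obtain ⟨ψ, hψs, hψ0, hψ, hψF⟩ := exists_contDiff_posDef_bump (δ := min ε (1 / 4)) (by positivity)
  set δ := min ε (1 / 4) with hδ
  have hδ4 : δ ≤ 1 / 4 := min_le_right _ _
  have hδε : δ ≤ ε := min_le_left _ _
  let B : UnitAddCircle → ℝ := AddCircle.liftIoc 1 (-(1 / 2)) ψ
  have hB : ∀ x : ℝ, |x| < 1 / 2 → B x = ψ x := fun x hx =>
    AddCircle.liftIoc_coe_apply (by rw [abs_lt] at hx; constructor <;> linarith)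
  have hper : ∀ (x : ℝ) (n : ℤ), ((x - n : ℝ) : UnitAddCircle) = x := by
    intro x n
    rw [AddCircle.coe_sub, sub_eq_self, AddCircle.coe_eq_zero_iff]
    exact ⟨n, by simp⟩
  have hB0 : ∀ x : UnitAddCircle, δ ≤ ‖x‖ → B x = 0 := by
    intro x hx
    obtain ⟨y, hy, rfl⟩ : ∃ y ∈ Set.Ioc (-(1 / 2) : ℝ) (-(1 / 2) + 1), (y : UnitAddCircle) = x :=
      ⟨_, (AddCircle.equivIoc 1 (-(1 / 2)) x).2, AddCircle.coe_equivIoc⟩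
    have hBy : B y = ψ y := AddCircle.liftIoc_coe_apply hy
    rw [hBy]
    apply hψ
    rw [UnitAddCircle.norm_eq] at hx
    have := round_le y 0
    simp only [Int.cast_zero, sub_zero] at this
    linarith
  refine ⟨B, ?_, ?_, fun x hx => hB0 x (hδε.trans hx), ?_⟩
  · rw [contDiff_iff_contDiffAt]
    intro x
    by_cases hx : |x - round x| < 1 / 2
    · have h1 : ContDiffAt ℝ ∞ (fun y : ℝ => ψ (y - round x)) x :=
        (hψs.comp (contDiff_id.sub contDiff_const)).contDiffAt
      refine h1.congr_of_eventuallyEq ?_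
      have hc : Continuous fun y : ℝ => |y - round x| := by fun_prop
      filter_upwards [hc.continuousAt.eventually_lt_const hx] with y hy
      rw [← hper y (round x)]
      exact hB _ hy
    · refine (contDiffAt_const (c := (0 : ℝ))).congr_of_eventuallyEq ?_
      have hc : Continuous fun y : ℝ => ‖(y : UnitAddCircle)‖ :=
        continuous_norm.comp (AddCircle.continuous_mk' 1)
      have hx' : δ < ‖(x : UnitAddCircle)‖ := by rw [UnitAddCircle.norm_eq]; linarith
      filter_upwards [hc.continuousAt.eventually_const_lt hx'] with y hy
      exact hB0 _ hy.le
  · have := hB 0 (by norm_num)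
    rw [hψ0] at this
    exact_mod_cast this
  · have key : ∀ n : ℤ, fourierCoeff (fun x => (B x : ℂ)) n = 𝓕 (fun x => (ψ x : ℂ)) (n : ℝ) := by
      intro n
      rw [fourierCoeff_eq_intervalIntegral _ _ (-(1 / 2)), Real.fourier_real_eq]
      rw [intervalIntegral.integral_of_le (by norm_num),
        ← setIntegral_eq_integral_of_forall_compl_eq_zero (s := Set.Ioc (-(1 / 2) : ℝ) (-(1 / 2) + 1))
          (f := fun v : ℝ => Real.fourierChar (-(v * n)) • (ψ v : ℂ))]
      · simp only [div_one, one_smul]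
        refine setIntegral_congr_fun measurableSet_Ioc fun x hx => ?_
        have hBx : B x = ψ x := AddCircle.liftIoc_coe_apply hx
        simp only [hBx, fourier_coe_apply, Real.fourierChar_apply, Circle.smul_def, smul_eq_mul]
        congr 2
        push_cast
        ring
      · intro x hx
        have : ψ x = 0 := by
          apply hψ
          by_contra! h
          rw [abs_lt] at h
          exact hx ⟨by linarith, by linarith⟩
        simp [this]
    intro n
    rw [key]
    exact hψF n

/-! ### A trigonometric approximate identity -/

namespace UnitAddCircle

/-- A nonnegative trigonometric polynomial on `ℝ/ℤ` whose only maximum is at `x`. -/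
noncomputable def peak (x t : UnitAddCircle) : ℝ := 2 + 2 * (fourier 1 (t - x) : ℂ).re

theorem continuous_peak (x : UnitAddCircle) : Continuous (peak x) := by
  unfold peak
  have := (fourier (T := 1) 1).continuous
  fun_prop

theorem norm_fourier_apply (n : ℤ) (x : UnitAddCircle) : ‖(fourier n x : ℂ)‖ = 1 := by
  rw [fourier_apply, Circle.norm_coe]

theorem abs_fourier_re_le_one (n : ℤ) (x : UnitAddCircle) : |(fourier n x : ℂ).re| ≤ 1 :=
  (Complex.abs_re_le_norm _).trans (norm_fourier_apply n x).le

theorem peak_nonneg (x t : UnitAddCircle) : 0 ≤ peak x t := by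
  have := (abs_le.1 (abs_fourier_re_le_one 1 (t - x))).1
  unfold peak
  linarith

theorem peak_self (x : UnitAddCircle) : peak x x = 4 := by
  simp only [peak, sub_self, fourier_eval_zero, Complex.one_re]
  norm_num

theorem peak_lt {x t : UnitAddCircle} (h : t ≠ x) : peak x t < peak x x := by
  have h1 := (abs_le.1 (abs_fourier_re_le_one 1 (t - x))).2
  rw [peak_self, peak]
  suffices (fourier 1 (t - x) : ℂ).re ≠ 1 by
    have := lt_of_le_of_ne h1 this
    linarith
  intro h2
  apply h
  have h3 : (fourier 1 (t - x) : ℂ) = 1 := by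
    have hn := norm_fourier_apply 1 (t - x)
    have hsq := Complex.sq_norm (fourier 1 (t - x))
    rw [hn, Complex.normSq_apply, h2] at hsq
    refine Complex.ext h2 ?_
    simpa using hsq
  rw [fourier_one] at h3
  have h4 : toCircle (t - x) = toCircle (0 : UnitAddCircle) := by
    rw [toCircle_zero]; exact Subtype.ext h3
  exact sub_eq_zero.1 (injective_toCircle one_ne_zero h4)

/-- `peak x t = |1 + e(t - x)|²`, so the binomial theorem applied to both conjugate factors yields
nonnegative coefficients. -/
theorem peak_pow (x t : UnitAddCircle) (n : ℕ) :
    ((peak x t ^ n : ℝ) : ℂ) = ∑ i ∈ Finset.range (n + 1), ∑ j ∈ Finset.range (n + 1),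
      ((n.choose i * n.choose j : ℕ) : ℂ) *
        (fourier (j - i : ℤ) x * fourier (-(j - i : ℤ)) t) := by
  have h1 : ((peak x t : ℝ) : ℂ) = (fourier 1 (t - x) + 1) * (fourier (-1) (t - x) + 1) := by
    have h2 : (fourier 1 (t - x) : ℂ) * fourier (-1) (t - x) = 1 := by
      rw [← fourier_add]; simp
    have h3 : (fourier 1 (t - x) : ℂ) + fourier (-1) (t - x) =
        (2 * (fourier 1 (t - x) : ℂ).re : ℝ) := by
      rw [fourier_neg, Complex.add_conj]
    rw [peak, Complex.ofReal_add, ← h3]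
    push_cast
    linear_combination -h2
  have hpow : ∀ (m : ℤ) (k : ℕ) (y : UnitAddCircle), (fourier m y : ℂ) ^ k = fourier (k * m) y := by
    intro m k y
    induction k with
    | zero => simp
    | succ k ih => rw [pow_succ, ih, ← fourier_add]; congr 1; push_cast; ring_nf
  have hsub : ∀ m : ℤ, (fourier m (t - x) : ℂ) = fourier (-m) x * fourier m t := by
    intro m
    rw [fourier_apply, fourier_apply, fourier_apply, ← Circle.coe_mul, ← toCircle_add, zsmul_sub,
      neg_smul, neg_add_eq_sub]
  rw [Complex.ofReal_pow, h1, mul_pow, add_pow, add_pow, Finset.sum_mul_sum]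
  refine Finset.sum_congr rfl fun i _ => Finset.sum_congr rfl fun j _ => ?_
  simp only [one_pow, mul_one, hpow]
  rw [mul_mul_mul_comm, ← fourier_add, hsub, mul_comm]
  push_cast
  congr 3 <;> congr 1 <;> ring

end UnitAddCircle

open UnitAddCircle

theorem TorusPosDef.integral_peak_pow_mul {f : UnitAddCircle → ℝ} (hf : TorusPosDef f)
    (hi : Integrable f haarAddCircle) (x : UnitAddCircle) (n : ℕ) :
    ∫ t, peak x t ^ n * f t ∂haarAddCircle =
      ∑ i ∈ Finset.range (n + 1), ∑ j ∈ Finset.range (n + 1), (n.choose i * n.choose j : ℕ) *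
        ((fourier (j - i : ℤ) x : ℂ).re *
          (fourierCoeff (fun x => (f x : ℂ)) (j - i : ℤ)).re) := by
  have hic : Integrable (fun t => (f t : ℂ)) haarAddCircle := hi.ofReal
  have h1 : ((∫ t, peak x t ^ n * f t ∂haarAddCircle : ℝ) : ℂ) =
      ∑ i ∈ Finset.range (n + 1), ∑ j ∈ Finset.range (n + 1),
        ((n.choose i * n.choose j : ℕ) : ℂ) *
        (fourier (j - i : ℤ) x * fourierCoeff (fun x => (f x : ℂ)) (j - i : ℤ)) := by
    rw [← integral_complex_ofReal]
    simp_rw [Complex.ofReal_mul, peak_pow, Finset.sum_mul, mul_assoc]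
    have hI : ∀ i j : ℕ, Integrable (fun t => ((n.choose i * n.choose j : ℕ) : ℂ) *
        (fourier (j - i : ℤ) x * (fourier (-(j - i : ℤ)) t * (f t : ℂ)))) haarAddCircle :=
      fun i j => ((hic.fourier_smul _).const_mul _).const_mul _
    rw [integral_finsetSum _ fun i _ => integrable_finsetSum _ fun j _ => hI i j]
    refine Finset.sum_congr rfl fun i _ => ?_
    rw [integral_finsetSum _ fun j _ => hI i j]
    refine Finset.sum_congr rfl fun j _ => ?_
    rw [integral_const_mul, integral_const_mul]
    rfl
  have h2 := congrArg Complex.re h1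
  rw [Complex.ofReal_re] at h2
  rw [h2]
  simp only [Complex.re_sum]
  refine Finset.sum_congr rfl fun i _ => Finset.sum_congr rfl fun j _ => ?_
  rw [← Complex.ofReal_natCast, Complex.re_ofReal_mul, Complex.mul_re, (hf _).2]
  simp

theorem UnitAddCircle.integral_peak_pow (x : UnitAddCircle) (n : ℕ) :
    ∫ t, peak x t ^ n ∂haarAddCircle = ∫ t, peak 0 t ^ n ∂haarAddCircle := by
  rw [← integral_sub_right_eq_self (fun t => peak 0 t ^ n) x]
  simp [peak]

/-- Powers of a function with a unique maximum concentrate there. By translation invariance the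
normalizing factor does not depend on `x`, so values at different points can be compared before the
limit. -/
theorem UnitAddCircle.tendsto_integral_peak_pow_mul {f : UnitAddCircle → ℝ}
    (hi : Integrable f haarAddCircle) {x : UnitAddCircle} (hx : ContinuousAt f x) :
    Tendsto (fun n : ℕ => (∫ t, peak 0 t ^ n ∂haarAddCircle)⁻¹ *
      ∫ t, peak x t ^ n * f t ∂haarAddCircle) atTop (𝓝 (f x)) := by
  have := tendsto_setIntegral_pow_smul_of_unique_maximum_of_isCompact_of_measure_nhdsWithin_pos
    (μ := haarAddCircle) (s := (Set.univ : Set UnitAddCircle)) (x₀ := x) (g := f) (c := peak x)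
    isCompact_univ (fun u hu hxu => by
      rw [Set.inter_univ]; exact hu.measure_pos _ ⟨x, hxu⟩) (continuous_peak x).continuousOn
    (fun y _ hy => peak_lt hy) (fun y _ => peak_nonneg x y) (by rw [peak_self]; norm_num)
    (Set.mem_univ x) hi.integrableOn hx.continuousWithinAt
  simpa only [Measure.restrict_univ, smul_eq_mul, integral_peak_pow x] using this

/-- A pointwise linear inequality between characters at `z`, `0`, `w` passes to positive definite
functions. -/
theorem TorusPosDef.apply_le {f : UnitAddCircle → ℝ} (hf : TorusPosDef f)
    (hi : Integrable f haarAddCircle) {z w : UnitAddCircle} (h0 : ContinuousAt f 0)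
    (hz : ContinuousAt f z) (hw : ContinuousAt f w) {α β : ℝ}
    (h : ∀ n : ℤ, (fourier n z : ℂ).re ≤ α + β * (fourier n w : ℂ).re) :
    f z ≤ α * f 0 + β * f w := by
  refine le_of_tendsto_of_tendsto' (tendsto_integral_peak_pow_mul hi hz)
    (((tendsto_integral_peak_pow_mul hi h0).const_mul α).add
      ((tendsto_integral_peak_pow_mul hi hw).const_mul β)) fun n => ?_
  rw [mul_left_comm α, mul_left_comm β, ← mul_add]
  refine mul_le_mul_of_nonneg_left ?_
    (inv_nonneg.2 (integral_nonneg fun t => pow_nonneg (peak_nonneg 0 t) n))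
  simp only [hf.integral_peak_pow_mul hi, Finset.mul_sum, ← Finset.sum_add_distrib]
  refine Finset.sum_le_sum fun i _ => Finset.sum_le_sum fun j _ => ?_
  rw [fourier_eval_zero, Complex.one_re]
  have h1 := mul_le_mul_of_nonneg_left (mul_le_mul_of_nonneg_right (h (j - i)) (hf (j - i)).1)
    (Nat.cast_nonneg (α := ℝ) (n.choose i * n.choose j))
  linarith

/-! ### Admissible functions from discrete measures -/

theorem openArc_eq : openArc = {((1 / 2 : ℝ) : UnitAddCircle)}ᶜ := by
  ext x
  obtain ⟨y, hy, rfl⟩ : ∃ y ∈ Set.Ioc (-(1 / 2) : ℝ) (-(1 / 2) + 1), (y : UnitAddCircle) = x :=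
    ⟨_, (AddCircle.equivIoc 1 (-(1 / 2)) x).2, AddCircle.coe_equivIoc⟩
  have hinj : ∀ u ∈ Set.Ioc (-(1 / 2) : ℝ) (-(1 / 2) + 1), (u : UnitAddCircle) = y ↔ u = y :=
    fun u hu => AddCircle.coe_eq_coe_iff_of_mem_Ioc hu hy
  simp only [openArc, Set.mem_image, Set.mem_compl_iff, Set.mem_singleton_iff]
  constructor
  · rintro ⟨u, hu, huy⟩ h
    rw [hinj u ⟨hu.1, by linarith [hu.2]⟩] at huy
    rw [eq_comm, hinj _ ⟨by norm_num, by norm_num⟩] at h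
    linarith [hu.2]
  · intro h
    refine ⟨y, ⟨hy.1, lt_of_le_of_ne (by linarith [hy.2]) fun h' => h (by rw [h'])⟩, rfl⟩

theorem Regularity.Holds.integrable {r : Regularity} {z : UnitAddCircle} {f : UnitAddCircle → ℝ}
    (h : r.Holds z f) :
    Integrable f haarAddCircle ∧ ContinuousAt f 0 ∧ ContinuousAt f z := by
  have hc : ∀ g : UnitAddCircle → ℝ, Continuous g →
      Integrable g haarAddCircle ∧ ContinuousAt g 0 ∧ ContinuousAt g z := fun g hg =>
    ⟨hg.integrable_of_hasCompactSupport (HasCompactSupport.of_compactSpace g),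
      hg.continuousAt, hg.continuousAt⟩
  cases r with
  | integrable => exact h
  | continuous => exact hc f h
  | smooth =>
    have h' : ContDiff ℝ ∞ (fun x : ℝ => f (x : UnitAddCircle)) := h
    exact hc f ((QuotientAddGroup.isQuotientMap_mk _).continuous_iff.2 h'.continuous)

theorem Regularity.holds_of_contDiff (r : Regularity) (z : UnitAddCircle) {f : UnitAddCircle → ℝ}
    (h : ContDiff ℝ ∞ (fun x : ℝ => f (x : UnitAddCircle))) : r.Holds z f := by
  cases r with
  | integrable => exact Regularity.Holds.integrable (r := .smooth) h
  | continuous => exact (QuotientAddGroup.isQuotientMap_mk _).continuous_iff.2 h.continuous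
  | smooth => exact h

/-- Finite positive definite measures on the torus avoiding `1/2` give lower bounds for the
extremal value. -/
theorem le_MStar_of_weights {ι : Type*} (r : Regularity) (z : UnitAddCircle) (s : Finset ι)
    (c : ι → ℝ) (t : ι → UnitAddCircle)
    (hpos : ∀ n : ℤ, 0 ≤ (∑ i ∈ s, (c i : ℂ) * fourier n (t i)).re ∧
      (∑ i ∈ s, (c i : ℂ) * fourier n (t i)).im = 0)
    (h0 : ∑ i ∈ s with t i = 0, c i = 1)
    (hhalf : ∀ i ∈ s, t i = ((1 / 2 : ℝ) : UnitAddCircle) → c i = 0) :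
    ((∑ i ∈ s with t i = z, c i : ℝ) : EReal) ≤ MStar r openArc z := by
  set w : UnitAddCircle := ((1 / 2 : ℝ) : UnitAddCircle) with hw
  -- For small `ε`, evaluating at `x` sees only the bumps centred exactly at `x`; this is needed at
  -- 0, `z` and 1/2.
  have hev : ∀ x : UnitAddCircle, ∀ᶠ ε in 𝓝[>] (0 : ℝ), ∀ i ∈ s, t i ≠ x → ε < ‖x - t i‖ := by
    intro x
    rw [Filter.eventually_all_finset]
    intro i _
    by_cases h : t i = x
    · simp [h]
    · have : 0 < ‖x - t i‖ := norm_pos_iff.2 (sub_ne_zero.2 (Ne.symm h))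
      filter_upwards [nhdsWithin_le_nhds (Iio_mem_nhds this)] with ε hε _ using hε
  obtain ⟨ε, hε0, hεz, hεw, hε⟩ :=
    ((hev 0).and ((hev z).and ((hev w).and self_mem_nhdsWithin))).exists
  obtain ⟨B, hBs, hB0, hB, hBF⟩ := UnitAddCircle.exists_smooth_torusPosDef_bump hε
  set f : UnitAddCircle → ℝ := fun x => ∑ i ∈ s, c i * B (x - t i) with hf
  have hBr := Regularity.Holds.integrable (r := .smooth) (z := 0) hBs
  have hval : ∀ x, (∀ i ∈ s, t i ≠ x → ε < ‖x - t i‖) → f x = ∑ i ∈ s with t i = x, c i := by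
    intro x hx
    rw [hf, Finset.sum_filter]
    refine Finset.sum_congr rfl fun i hi => ?_
    split_ifs with h
    · simp [h, hB0]
    · rw [hB _ (hx i hi h).le, mul_zero]
  have hfs : ContDiff ℝ ∞ (fun x : ℝ => f (x : UnitAddCircle)) := by
    refine ContDiff.sum fun i _ => contDiff_const.mul ?_
    obtain ⟨y, hy⟩ := QuotientAddGroup.mk_surjective (t i)
    have : ContDiff ℝ ∞ ((fun x : ℝ => B (x : UnitAddCircle)) ∘ fun x : ℝ => x - y) :=
      hBs.comp (contDiff_id.sub contDiff_const)
    rw [← hy]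
    exact this
  have hmem : f ∈ FStar r openArc z := by
    refine ⟨r.holds_of_contDiff z hfs, ?_, ?_, ?_⟩
    · rw [openArc_eq, Set.subset_compl_singleton_iff, notMem_tsupport_iff_eventuallyEq]
      have : ∀ᶠ x in 𝓝 w, ∀ i ∈ s, t i ≠ w → ε < ‖x - t i‖ := by
        rw [Filter.eventually_all_finset]
        intro i hi
        by_cases h : t i = w
        · simp [h]
        · have hc : Continuous fun x : UnitAddCircle => ‖x - t i‖ := by fun_prop
          filter_upwards [hc.continuousAt.eventually_const_lt (hεw i hi h)] with x hx _ using hx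
      filter_upwards [this] with x hx
      refine Finset.sum_eq_zero fun i hi => ?_
      by_cases h : t i = w
      · rw [hhalf i hi h, zero_mul]
      · rw [hB _ (hx i hi h).le, mul_zero]
    · rw [hval 0 hε0, h0]
    · intro n
      have key : fourierCoeff (fun x => (f x : ℂ)) n =
          (∑ i ∈ s, (c i : ℂ) * fourier (-n) (t i)) * fourierCoeff (fun x => (B x : ℂ)) n := by
        have h1 : (fun x => (f x : ℂ)) = ∑ i ∈ s, fun x => (c i : ℂ) * (B (x - t i) : ℂ) := by
          ext x; simp [hf]
        have h2 : ∀ i, Integrable (fun x => (B (x - t i) : ℂ)) haarAddCircle := fun i =>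
          (hBr.1.comp_sub_right (t i)).ofReal
        rw [h1, fourierCoeff.sum _ _ fun i _ => (h2 i).const_mul _, Finset.sum_apply, Finset.sum_mul]
        refine Finset.sum_congr rfl fun i _ => ?_
        rw [fourierCoeff.const_mul, mul_assoc]
        congr 1
        rw [fourierCoeff, fourierCoeff, ← integral_const_mul,
          ← integral_sub_right_eq_self (fun x => fourier (-n) (t i) * (fourier (-n) x • (B x : ℂ))) (t i)]
        congr 1
        ext x
        rw [smul_eq_mul, smul_eq_mul, ← mul_assoc]
        congr 1
        simp only [fourier_apply]
        rw [← Circle.coe_mul, ← toCircle_add, ← zsmul_add, add_sub_cancel]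
      obtain ⟨ha, hb⟩ := hpos (-n)
      obtain ⟨hc, hd⟩ := hBF n
      rw [key, Complex.mul_re, Complex.mul_im, hb, hd]
      exact ⟨by simpa using mul_nonneg ha hc, by simp⟩
  rw [← hval z hεz]
  exact le_iSup₂ (f := fun f (_ : f ∈ FStar r openArc z) => ((f z : ℝ) : EReal)) f hmem

/-! ### Upper bounds -/

theorem UnitAddCircle.fourier_coe (n : ℤ) (x : ℝ) :
    (fourier n (x : UnitAddCircle) : ℂ) = Complex.exp ((2 * Real.pi * (n * x) : ℝ) * Complex.I) := by
  rw [fourier_coe_apply]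
  congr 1
  push_cast
  ring

theorem UnitAddCircle.fourier_coe_re (n : ℤ) (x : ℝ) :
    (fourier n (x : UnitAddCircle) : ℂ).re = Real.cos (2 * Real.pi * (n * x)) := by
  rw [fourier_coe, Complex.exp_ofReal_mul_I_re]

theorem MStar_le {r : Regularity} {z α β : ℝ}
    (h : ∀ n : ℤ, Real.cos (2 * Real.pi * (n * z)) ≤ α + β * Real.cos (n * Real.pi)) :
    MStar r openArc (z : UnitAddCircle) ≤ (α : EReal) := by
  refine iSup₂_le fun f hf => EReal.coe_le_coe ?_
  obtain ⟨hr, hsupp, h0, hpos⟩ := hf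
  obtain ⟨hi, hc0, hcz⟩ := hr.integrable
  rw [openArc_eq, Set.subset_compl_singleton_iff, notMem_tsupport_iff_eventuallyEq] at hsupp
  -- Vanishing near 1/2 supplies the continuity there that the integrable class does not assume.
  have hw : ContinuousAt f ((1 / 2 : ℝ) : UnitAddCircle) :=
    continuousAt_const.congr hsupp.symm
  have := hpos.apply_le hi hc0 hcz hw (α := α) (β := β) fun n => by
    rw [fourier_coe_re, fourier_coe_re]
    convert h n using 4
    ring
  rw [h0, hsupp.eq_of_nhds] at this
  simpa using this

theorem MStar_le_one (r : Regularity) (z : ℝ) : MStar r openArc (z : UnitAddCircle) ≤ 1 :=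
  MStar_le (α := 1) (β := 0) fun n => by simpa using Real.cos_le_one _

theorem Real.cos_two_pi_mul_div_le_of_not_dvd {m : ℤ} {q : ℕ} (hq : 0 < q) (hm : ¬ (q : ℤ) ∣ m) :
    Real.cos (2 * Real.pi * (m / q)) ≤ Real.cos (2 * Real.pi / q) := by
  have hq' : (0 : ℝ) < q := by exact_mod_cast hq
  have hqz : (0 : ℤ) < q := by exact_mod_cast hq
  set d := m % q with hd
  have hd1 : 1 ≤ d := by
    have h1 := Int.emod_nonneg m hqz.ne'
    have h2 : d ≠ 0 := fun h => hm (Int.dvd_of_emod_eq_zero h)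
    omega
  have hdq : d + 1 ≤ q := Int.emod_lt_of_pos m hqz
  have hd1' : (1 : ℝ) ≤ d := by exact_mod_cast hd1
  have hdq' : (d : ℝ) + 1 ≤ q := by exact_mod_cast hdq
  have hmd : (m : ℝ) = d + q * (m / q : ℤ) := by
    exact_mod_cast (Int.emod_add_mul_ediv m q).symm
  have hcos : Real.cos (2 * Real.pi * (m / q)) = Real.cos (2 * Real.pi * d / q) := by
    rw [hmd, ← Real.cos_add_int_mul_two_pi (2 * Real.pi * d / q) (m / q : ℤ)]
    congr 1
    field_simp
  have hpi := Real.pi_pos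
  -- The cosine increases with distance from `π`, and the angle of a nonzero residue is no farther
  -- from `π` than `2π/q` is.
  have hkey : |2 * Real.pi * d / q - Real.pi| ≤ Real.pi - 2 * Real.pi / q := by
    have e1 : 2 * Real.pi * d / q - Real.pi = (2 * Real.pi * d - Real.pi * q) / q := by field_simp
    have e2 : Real.pi - 2 * Real.pi / q = (Real.pi * q - 2 * Real.pi) / q := by field_simp
    rw [e1, e2, abs_div, abs_of_pos hq']
    refine div_le_div_of_nonneg_right (abs_le.2 ⟨?_, ?_⟩) hq'.le <;> nlinarith
  have := Real.cos_le_cos_of_nonneg_of_le_pi (abs_nonneg _)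
    (by have : 0 ≤ 2 * Real.pi / q := by positivity
        linarith) hkey
  rw [Real.cos_abs, Real.cos_sub_pi, Real.cos_pi_sub] at this
  rw [hcos]
  linarith

theorem MStar_le_of_even (r : Regularity) {p : ℤ} {q : ℕ} (hq : 0 < q) (hpq : IsCoprime p (q : ℤ))
    (he : Even q) :
    MStar r openArc (((p : ℝ) / (q : ℝ) : ℝ) : UnitAddCircle) ≤
      (((1 / 2 : ℝ) * (1 + Real.cos (2 * Real.pi / (q : ℝ))) : ℝ) : EReal) := by
  have h2q : (2 : ℤ) ∣ q := by exact_mod_cast he.two_dvd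
  refine MStar_le (β := 1 / 2 * (1 - Real.cos (2 * Real.pi / q))) fun n => ?_
  rw [Real.cos_int_mul_pi]
  rcases Int.even_or_odd n with hn | hn
  · rw [hn.neg_one_zpow]
    have := Real.cos_le_one (2 * Real.pi * (n * (p / q)))
    linarith
  · have hp : ¬ (q : ℤ) ∣ n * p := by
      intro hd
      have h1 : (q : ℤ) ∣ n := hpq.symm.dvd_of_dvd_mul_right hd
      exact (Int.not_even_iff_odd.2 hn) (even_iff_two_dvd.2 (h2q.trans h1))
    have := Real.cos_two_pi_mul_div_le_of_not_dvd hq hp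
    rw [hn.neg_one_zpow]
    push_cast at this
    rw [mul_div_assoc] at this
    linarith

/-! ### Lower bounds -/

theorem sum_range_exp_two_pi_mul_div {q : ℕ} (hq : 0 < q) (m : ℤ) :
    ∃ x : ℝ, 0 ≤ x ∧
      ∑ k ∈ Finset.range q, Complex.exp ((2 * Real.pi * (m * k / q) : ℝ) * Complex.I) = x := by
  have hq' : (q : ℂ) ≠ 0 := by exact_mod_cast hq.ne'
  set ζ : ℂ := Complex.exp ((2 * Real.pi * (m / q) : ℝ) * Complex.I) with hζ
  have h1 : ∀ k : ℕ, Complex.exp ((2 * Real.pi * (m * k / q) : ℝ) * Complex.I) = ζ ^ k := by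
    intro k
    rw [hζ, ← Complex.exp_nat_mul]
    congr 1
    push_cast
    ring
  simp_rw [h1]
  by_cases h : ζ = 1
  · exact ⟨q, Nat.cast_nonneg q, by simp [h]⟩
  · refine ⟨0, le_rfl, ?_⟩
    have : ζ ^ q = 1 := by
      rw [← h1, Complex.exp_eq_one_iff]
      refine ⟨m, ?_⟩
      push_cast
      field_simp
    rw [geom_sum_eq h, this]
    simp

/-- Weights `a + b cos (2πk/q)` sit at the points `k * p / q`. Writing the cosine as two
exponentials turns the transform into nonnegative multiples of complete sums over `q`-th roots of
unity. -/
theorem le_MStar_rat (r : Regularity) {p : ℤ} {q : ℕ} (hq : 0 < q) (hpq : IsCoprime p (q : ℤ))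
    {a b : ℝ} (ha : 0 ≤ a) (hb : 0 ≤ b) (hab : a + b = 1)
    (hhalf : ∀ k < q, ∀ n : ℤ, 2 * (k * p) = q * (2 * n + 1) →
      a + b * Real.cos (2 * Real.pi * (k / q)) = 0) :
    ((a + b * Real.cos (2 * Real.pi / q) : ℝ) : EReal) ≤
      MStar r openArc (((p : ℝ) / (q : ℝ) : ℝ) : UnitAddCircle) := by
  have hq' : (q : ℝ) ≠ 0 := by exact_mod_cast hq.ne'
  let c : ℕ → ℝ := fun k => a + b * Real.cos (2 * Real.pi * (k / q))
  let t : ℕ → UnitAddCircle := fun k => ((k * (p / q) : ℝ) : UnitAddCircle)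
  have hdvd : ∀ m : ℤ, ((m * (p / q) : ℝ) : UnitAddCircle) = 0 ↔ (q : ℤ) ∣ m := by
    intro m
    rw [AddCircle.coe_eq_zero_iff]
    constructor
    · rintro ⟨n, hn⟩
      rw [zsmul_eq_mul, mul_one] at hn
      field_simp at hn
      have hn' : (q : ℤ) * n = m * p := by rw [mul_comm]; exact_mod_cast hn
      exact hpq.symm.dvd_of_dvd_mul_right ⟨n, hn'.symm⟩
    · rintro ⟨n, rfl⟩
      refine ⟨n * p, ?_⟩
      rw [zsmul_eq_mul]
      push_cast
      field_simp
  have ht0 : (Finset.range q).filter (fun k => t k = 0) = {0} := by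
    ext k
    have := hdvd k
    rw [Int.cast_natCast] at this
    simp only [Finset.mem_filter, Finset.mem_range, Finset.mem_singleton, t, this,
      Int.natCast_dvd_natCast]
    exact ⟨fun ⟨h1, h2⟩ => Nat.eq_zero_of_dvd_of_lt h2 h1, by rintro rfl; simpa using hq⟩
  -- The residue `1 % q` covers `q = 1`, where `z` coincides with 0.
  have htz : (Finset.range q).filter (fun k => t k = ((p / q : ℝ) : UnitAddCircle)) = {1 % q} := by
    ext k
    have h1 := hdvd (k - 1)
    have h2 : (((k - 1 : ℤ) : ℝ) * (p / q) : ℝ) = k * (p / q) - p / q := by push_cast; ring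
    rw [h2, AddCircle.coe_sub, sub_eq_zero] at h1
    simp only [Finset.mem_filter, Finset.mem_range, Finset.mem_singleton, t, h1]
    constructor
    · rintro ⟨hk, hd⟩
      have h3 : 1 ≡ k [MOD q] := Nat.modEq_iff_dvd.2 (by exact_mod_cast hd)
      rw [h3, Nat.mod_eq_of_lt hk]
    · rintro rfl
      exact ⟨Nat.mod_lt _ hq, by exact_mod_cast Nat.modEq_iff_dvd.1 (Nat.mod_modEq 1 q).symm⟩
  have hcz : c (1 % q) = a + b * Real.cos (2 * Real.pi / q) := by
    rcases Nat.lt_or_ge 1 q with h | h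
    · simp only [c, Nat.mod_eq_of_lt h, Nat.cast_one, mul_one_div]
    · obtain rfl : q = 1 := by omega
      simp [c]
  have := le_MStar_of_weights r (((p : ℝ) / (q : ℝ) : ℝ) : UnitAddCircle) (Finset.range q) c t
    ?_ ?_ ?_
  · rwa [htz, Finset.sum_singleton, hcz] at this
  · intro n
    obtain ⟨x, hx, hx'⟩ := sum_range_exp_two_pi_mul_div hq (n * p)
    obtain ⟨y, hy, hy'⟩ := sum_range_exp_two_pi_mul_div hq (n * p + 1)
    obtain ⟨w, hw, hw'⟩ := sum_range_exp_two_pi_mul_div hq (n * p - 1)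
    have : ∑ k ∈ Finset.range q, (c k : ℂ) * fourier n (t k) =
        ((a * x + b / 2 * y + b / 2 * w : ℝ) : ℂ) := by
      push_cast
      rw [← hx', ← hy', ← hw', Finset.mul_sum, Finset.mul_sum, Finset.mul_sum,
        ← Finset.sum_add_distrib, ← Finset.sum_add_distrib]
      refine Finset.sum_congr rfl fun k _ => ?_
      have e1 : Complex.exp ((2 * Real.pi * ((n * p + 1 : ℤ) * k / q) : ℝ) * Complex.I) =
          Complex.exp ((2 * Real.pi * ((n * p : ℤ) * k / q) : ℝ) * Complex.I) *
          Complex.exp ((2 * Real.pi * (k / q) : ℝ) * Complex.I) := by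
        rw [← Complex.exp_add]; congr 1; push_cast; ring
      have e2 : Complex.exp ((2 * Real.pi * ((n * p - 1 : ℤ) * k / q) : ℝ) * Complex.I) =
          Complex.exp ((2 * Real.pi * ((n * p : ℤ) * k / q) : ℝ) * Complex.I) *
          Complex.exp (-(2 * Real.pi * (k / q) : ℝ) * Complex.I) := by
        rw [← Complex.exp_add]; congr 1; push_cast; ring
      have e3 : (fourier n (t k) : ℂ) =
          Complex.exp ((2 * Real.pi * ((n * p : ℤ) * k / q) : ℝ) * Complex.I) := by
        simp only [t]
        rw [fourier_coe]; congr 1; push_cast; ring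
      rw [e1, e2, e3]
      simp only [c, Complex.ofReal_add, Complex.ofReal_mul b,
        Complex.ofReal_cos, Complex.cos]
      ring
    rw [this]
    exact ⟨by rw [Complex.ofReal_re]; positivity, Complex.ofReal_im _⟩
  · rw [ht0, Finset.sum_singleton]
    simpa [c] using hab
  · intro k hk htk
    simp only [t] at htk
    rw [← sub_eq_zero, ← AddCircle.coe_sub, AddCircle.coe_eq_zero_iff] at htk
    obtain ⟨n, hn⟩ := htk
    rw [zsmul_eq_mul, mul_one] at hn
    refine hhalf k (Finset.mem_range.1 hk) n ?_
    have : (2 * (k * p) : ℝ) = q * (2 * n + 1) := by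
      rw [hn]; field_simp; ring
    exact_mod_cast this

theorem le_MStar_irrational (r : Regularity) {z : ℝ} (hz : Irrational z) :
    1 ≤ MStar r openArc (z : UnitAddCircle) := by
  have hrat : ∀ (m : ℤ) (x : ℚ), (m * z : ℝ) = x → m = 0 := by
    intro m x h
    by_contra hm
    exact (hz.intCast_mul hm).ne_rat x h
  have hint : ∀ m : ℤ, ((m * z : ℝ) : UnitAddCircle) = 0 ↔ m = 0 := by
    intro m
    rw [AddCircle.coe_eq_zero_iff]
    constructor
    · rintro ⟨n, hn⟩
      exact hrat m n (by rw [← hn]; simp)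
    · rintro rfl
      exact ⟨0, by simp⟩
  have hN : ∀ M : ℕ, (((M : ℝ) / (M + 1) : ℝ) : EReal) ≤ MStar r openArc (z : UnitAddCircle) := by
    intro M
    have hM : (M + 1 : ℝ) ≠ 0 := by positivity
    -- Pairs `(i, j)` at `(i - j) * z` encode the Fejér kernel: the transform is a normalized
    -- squared modulus, with `M + 1` pairs over 0 and `M` over `z`.
    let t : ℕ × ℕ → UnitAddCircle := fun k => (((k.1 - k.2 : ℤ) * z : ℝ) : UnitAddCircle)
    let s := Finset.range (M + 1) ×ˢ Finset.range (M + 1)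
    have ht0 : s.filter (fun k => t k = 0) = (Finset.range (M + 1)).image (fun j => (j, j)) := by
      ext ⟨i, j⟩
      simp only [Finset.mem_filter, t, hint, s, Finset.mem_product, Finset.mem_range,
        Finset.mem_image, Prod.mk.injEq]
      constructor
      · rintro ⟨⟨h1, h2⟩, h3⟩; exact ⟨i, h1, rfl, by omega⟩
      · rintro ⟨k, h1, rfl, rfl⟩; exact ⟨⟨h1, h1⟩, by omega⟩
    have htz : s.filter (fun k => t k = (z : UnitAddCircle)) =
        (Finset.range M).image (fun j => (j + 1, j)) := by
      ext ⟨i, j⟩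
      have h1 := hint (i - j - 1)
      have h2 : (((i - j - 1 : ℤ) : ℝ) * z : ℝ) = (i - j : ℤ) * z - z := by push_cast; ring
      rw [h2, AddCircle.coe_sub, sub_eq_zero] at h1
      simp only [Finset.mem_filter, t, h1, s, Finset.mem_product, Finset.mem_range,
        Finset.mem_image, Prod.mk.injEq]
      constructor
      · rintro ⟨⟨h1, h2⟩, h3⟩; exact ⟨j, by omega, by omega, rfl⟩
      · rintro ⟨k, h1, rfl, rfl⟩; exact ⟨⟨by omega, by omega⟩, by push_cast; ring⟩
    have := le_MStar_of_weights r (z : UnitAddCircle) s (fun _ => ((M : ℝ) + 1)⁻¹) t ?_ ?_ ?_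
    · rw [htz, Finset.sum_const, Finset.card_image_of_injective _ fun a b h => (Prod.ext_iff.1 h).2,
        Finset.card_range, nsmul_eq_mul] at this
      exact this
    · intro n
      set S : ℂ := ∑ j ∈ Finset.range (M + 1), fourier n ((j * z : ℝ) : UnitAddCircle) with hS
      have : ∑ k ∈ s, ((((M : ℝ) + 1)⁻¹ : ℝ) : ℂ) * fourier n (t k) =
          ((((M : ℝ) + 1)⁻¹ * Complex.normSq S : ℝ) : ℂ) := by
        rw [Complex.ofReal_mul, ← Complex.mul_conj, ← Finset.mul_sum, hS, map_sum,
          Finset.sum_mul_sum, Finset.sum_product]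
        congr 1
        refine Finset.sum_congr rfl fun i _ => Finset.sum_congr rfl fun j _ => ?_
        rw [← fourier_neg]
        simp only [t, fourier_coe]
        rw [← Complex.exp_add]
        congr 1
        push_cast
        ring
      rw [this]
      exact ⟨by rw [Complex.ofReal_re]; exact mul_nonneg (by positivity) (Complex.normSq_nonneg _),
        Complex.ofReal_im _⟩
    · rw [ht0, Finset.sum_const, Finset.card_image_of_injective _ fun a b h => (Prod.ext_iff.1 h).2,
        Finset.card_range, nsmul_eq_mul]
      push_cast
      exact mul_inv_cancel₀ hM
    · rintro ⟨i, j⟩ - h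
      exfalso
      simp only [t] at h
      rw [← sub_eq_zero, ← AddCircle.coe_sub, AddCircle.coe_eq_zero_iff] at h
      obtain ⟨n, hn⟩ := h
      rw [zsmul_eq_mul, mul_one] at hn
      have h0 := hrat (i - j) (n + 1 / 2) (by push_cast at hn ⊢; linarith)
      rw [h0] at hn
      have : (2 * n + 1 : ℝ) = 0 := by push_cast at hn; linarith
      have : 2 * n + 1 = 0 := by exact_mod_cast this
      omega
  have hlim : Tendsto (fun M : ℕ => (((M : ℝ) / (M + 1) : ℝ) : EReal)) atTop (𝓝 ((1 : ℝ) : EReal)) :=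
    (continuous_coe_real_ereal.tendsto 1).comp (tendsto_natCast_div_add_atTop 1)
  exact le_of_tendsto' hlim hN

/-! ### Matching the bounds -/

theorem mainTheorem7 (r : Regularity) :
    (∀ (p : ℤ) (q : ℕ), 0 < q → IsCoprime p (q : ℤ) → Even q →
      MStar r openArc (((p : ℝ) / (q : ℝ) : ℝ) : UnitAddCircle) =
        (((1 / 2 : ℝ) * (1 + Real.cos (2 * Real.pi / (q : ℝ))) : ℝ) : EReal)) ∧
    (∀ (p : ℤ) (q : ℕ), 0 < q → IsCoprime p (q : ℤ) → Odd q →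
      MStar r openArc (((p : ℝ) / (q : ℝ) : ℝ) : UnitAddCircle) = 1) ∧
    (∀ z : ℝ, Irrational z → MStar r openArc (z : UnitAddCircle) = 1) := by
  refine ⟨fun p q hq hpq he => le_antisymm (MStar_le_of_even r hq hpq he) ?_,
    fun p q hq hpq ho => le_antisymm (MStar_le_one r _) ?_,
    fun z hz => le_antisymm (MStar_le_one r z) (le_MStar_irrational r hz)⟩
  · rw [mul_add, mul_one]
    refine le_MStar_rat r hq hpq (by norm_num) (by norm_num) (by norm_num) fun k hk n hn => ?_
    obtain ⟨m, rfl⟩ := he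
    have hm : m ≠ 0 := by omega
    -- With `q = 2m`, the point 1/2 occurs only at `k = m`: `m` divides `k`, `k < 2m`, and `k ≠ 0`.
    -- There the weight is `(1 + cos π)/2 = 0`.
    have h1 : (k * p : ℤ) = m * (2 * n + 1) := by push_cast at hn; linarith
    have h2 : IsCoprime (m : ℤ) p := (hpq.of_isCoprime_of_dvd_right ⟨2, by push_cast; ring⟩).symm
    obtain ⟨j, hj⟩ : m ∣ k := Int.natCast_dvd_natCast.1 (h2.dvd_of_dvd_mul_right ⟨_, h1⟩)
    have hj2 : j < 2 := by
      by_contra! h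
      have := Nat.mul_le_mul_left m h
      omega
    have hj1 : j ≠ 0 := by
      rintro rfl
      rw [mul_zero] at hj
      subst hj
      have h3 : (m : ℤ) * (2 * n + 1) = 0 := by rw [← h1]; simp
      rcases mul_eq_zero.1 h3 with h | h <;> omega
    obtain rfl : j = 1 := by omega
    rw [mul_one] at hj
    subst hj
    have hk' : (k : ℝ) ≠ 0 := by exact_mod_cast hm
    have : 2 * Real.pi * (k / (k + k : ℕ)) = Real.pi := by
      push_cast
      field_simp
      ring
    rw [this, Real.cos_pi]
    norm_num
  · have := le_MStar_rat r hq hpq (a := 1) (b := 0) (by norm_num) (by norm_num) (by norm_num)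
      fun k _ n hn => ?_
    · simpa using this
    · exfalso
      have h1 : Odd ((q : ℤ) * (2 * n + 1)) := ((Int.odd_coe_nat q).2 ho).mul ⟨n, rfl⟩
      rw [← hn] at h1
      exact Int.not_even_iff_odd.2 h1 (even_two_mul _)
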